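/- Theorem (completeness for polytopes with the topological contact). Let $\mathcal L$ be the quantifier-free language with countably infinitely many individual variables, a unary function symbol $-$, a binary function symbol $+$, equality $\equiv$, a binary predicate symbol $C$, and the connectives $\neg,\vee$. Write $\varphi\Rightarrow\psi$ for $\neg\varphi\vee\psi$, $\varphi\wedge\psi$ for $\neg(\neg\varphi\vee\neg\psi)$, $\varphi\Leftrightarrow\psi$ for $(\varphi\Rightarrow\psi)\wedge(\psi\Rightarrow\varphi)$, $a\cdot b$ for $-((-a)+(-b))$, $0$ for $x\cdot(-x)$ with $x$ a fixed variable, $1$ for $-0$, and $a\not\equiv b$ for $\neg(a\equiv b)$. Let $\mathfrak F$ be the formal system in $\mathcal L$ whose only rule of inference is modus ponens and whose axioms are all instances of: a complete set of axiom schemes for classical propositional logic; the axioms of equality (reflexivity, symmetry, transitivity, and congruence with respect to $-$, $+$ and $C$); the axioms of Boolean algebras with $0\not\equiv 1$ (associativity, commutativity, absorption, distributivity, complementation); the contact axioms $$\neg C(0,a),\qquad C(a,b+c)\Leftrightarrow (C(a,b)\vee C(a,c)),\qquad C(a,b)\Rightarrow C(b,a),\qquad a\not\equiv 0\Rightarrow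 C(a,a);$$ and the connectedness axiom $a\not\equiv 0\Rightarrow(a\not\equiv 1\Rightarrow C(a,-a))$. Let $T(\mathfrak F)$ be the set of theorems of $\mathfrak F$. For $n\ge 1$, a basic polytope in $\mathbb R^n$ is a set $\mathrm{Cl}(\mathrm{Int}(\alpha_1\cap\dots\cap\alpha_k))$ with $\alpha_1,\dots,\alpha_k$ closed half-spaces, and a polytope is a finite union of basic polytopes. Let $\langle\mathcal P^n,C\rangle$ be the structure for $\mathcal L$ whose elements are the polytopes in $\mathbb R^n$, in which $-A=\mathrm{Cl}(\mathbb R^n\setminus A)$, $A+B=A\cup B$, and $C(A,B)$ holds iff $A\cap B\neq\emptyset$. A formula is true in $\langle\mathcal P^n,C\rangle$ if it holds under every valuation of the variables by polytopes; let $L(\{\langle\mathcal P^n,C\rangle\})$ be the set of the formulas of $\mathcal L$ true in $\langle\mathcal P^n,C\rangle$. Then for every positive integer $n$, every formula of $\mathcal L$ that is true in $\langle\mathcal P^n,C\rangle$ is a theorem of $\mathfrak F$. Hence $L(\{\langle\mathcal P^n,C\rangle\})=T(\mathfrak F)$ for every positive integer $n$; in particular, $L(\{\langle\mathcal P^m,C\rangle\})=L(\{\langle\mathcal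 P^n,C\rangle\})$ for all positive integers $m$ and $n$. -/

import Mathlib

namespace ContactLogic

/-! The quantifier-free language with complement, join, equality and contact. -/

/-- Terms over the countable set `ℕ` of individual variables. -/
inductive CTerm : Type
  | var : ℕ → CTerm
  | compl : CTerm → CTerm
  | join : CTerm → CTerm → CTerm

namespace CTerm

/-- `a · b` abbreviates `-((-a) + (-b))`. -/
def meet (a b : CTerm) : CTerm := compl (join (compl a) (compl b))

/-- `0` abbreviates `a · (-a)`; here `a` is the first individual variable. The complementation
axioms make all the terms `b · (-b)` provably equal to it. -/
def zero : CTerm := meet (var 0) (compl (var 0))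

/-- `1` abbreviates `-0`. -/
def one : CTerm := compl zero

end CTerm

/-- Quantifier-free formulas. -/
inductive CFormula : Type
  | eq : CTerm → CTerm → CFormula
  | contact : CTerm → CTerm → CFormula
  | neg : CFormula → CFormula
  | or : CFormula → CFormula → CFormula

namespace CFormula

/-- `φ ∧ ψ` abbreviates `¬(¬φ ∨ ¬ψ)`. -/
def and (φ ψ : CFormula) : CFormula := neg (or (neg φ) (neg ψ))

/-- `φ ⇒ ψ` abbreviates `¬φ ∨ ψ`. -/
def imp (φ ψ : CFormula) : CFormula := or (neg φ) ψ

/-- `φ ⇔ ψ` abbreviates `(φ ⇒ ψ) ∧ (ψ ⇒ φ)`. -/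
def iff (φ ψ : CFormula) : CFormula := and (imp φ ψ) (imp ψ φ)

end CFormula

/-! The formal system for connected contact algebras. -/

open CTerm CFormula in
/-- The axioms of the formal system. -/
inductive IsAxiom : CFormula → Prop
  -- classical propositional logic
  | prop_k (φ ψ : CFormula) : IsAxiom (imp φ (imp ψ φ))
  | prop_s (φ ψ χ : CFormula) :
      IsAxiom (imp (imp φ (imp ψ χ)) (imp (imp φ ψ) (imp φ χ)))
  | prop_contra (φ ψ : CFormula) : IsAxiom (imp (imp (neg φ) (neg ψ)) (imp ψ φ))
  | prop_or_left (φ ψ : CFormula) : IsAxiom (imp φ (or φ ψ))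
  | prop_or_right (φ ψ : CFormula) : IsAxiom (imp ψ (or φ ψ))
  | prop_or_elim (φ ψ χ : CFormula) :
      IsAxiom (imp (imp φ χ) (imp (imp ψ χ) (imp (or φ ψ) χ)))
  -- equality
  | eq_refl (a : CTerm) : IsAxiom (eq a a)
  | eq_symm (a b : CTerm) : IsAxiom (imp (eq a b) (eq b a))
  | eq_trans (a b c : CTerm) : IsAxiom (imp (eq a b) (imp (eq b c) (eq a c)))
  | eq_compl (a b : CTerm) : IsAxiom (imp (eq a b) (eq (compl a) (compl b)))
  | eq_join (a b c d : CTerm) :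
      IsAxiom (imp (eq a b) (imp (eq c d) (eq (join a c) (join b d))))
  | eq_contact (a b c d : CTerm) :
      IsAxiom (imp (eq a b) (imp (eq c d) (imp (contact a c) (contact b d))))
  -- Boolean algebras
  | join_assoc (a b c : CTerm) : IsAxiom (eq (join a (join b c)) (join (join a b) c))
  | meet_assoc (a b c : CTerm) : IsAxiom (eq (meet a (meet b c)) (meet (meet a b) c))
  | join_comm (a b : CTerm) : IsAxiom (eq (join a b) (join b a))
  | meet_comm (a b : CTerm) : IsAxiom (eq (meet a b) (meet b a))
  | join_absorb (a b : CTerm) : IsAxiom (eq (join a (meet a b)) a)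
  | meet_absorb (a b : CTerm) : IsAxiom (eq (meet a (join a b)) a)
  | meet_distrib (a b c : CTerm) :
      IsAxiom (eq (meet a (join b c)) (join (meet a b) (meet a c)))
  | join_distrib (a b c : CTerm) :
      IsAxiom (eq (join a (meet b c)) (meet (join a b) (join a c)))
  | join_compl (a : CTerm) : IsAxiom (eq (join a (compl a)) one)
  | meet_compl (a : CTerm) : IsAxiom (eq (meet a (compl a)) zero)
  | zero_ne_one : IsAxiom (neg (eq zero one))
  -- contact relations
  | contact_zero (a : CTerm) : IsAxiom (neg (contact zero a))
  | contact_join (a b c : CTerm) :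
      IsAxiom (iff (contact a (join b c)) (or (contact a b) (contact a c)))
  | contact_symm (a b : CTerm) : IsAxiom (imp (contact a b) (contact b a))
  | contact_self (a : CTerm) : IsAxiom (imp (neg (eq a zero)) (contact a a))
  -- connectedness
  | connected (a : CTerm) :
      IsAxiom (imp (neg (eq a zero)) (imp (neg (eq a one)) (contact a (compl a))))

/-- Theorems of the formal system; modus ponens is the only rule of inference. -/
inductive Provable : CFormula → Prop
  | ax {φ : CFormula} : IsAxiom φ → Provable φ
  | mp {φ ψ : CFormula} : Provable (CFormula.imp φ ψ) → Provable φ → Provable ψ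

/-- The set of theorems of the formal system. -/
def theoremSet : Set CFormula := {φ | Provable φ}

/-! Semantics. -/

universe u

/-- Structures for the language. -/
structure CStructure where
  carrier : Type u
  nonempty : Nonempty carrier
  compl : carrier → carrier
  join : carrier → carrier → carrier
  contact : carrier → carrier → Prop

namespace CStructure

/-- The value of a term under a valuation. -/
def eval (A : CStructure.{u}) (v : ℕ → A.carrier) : CTerm → A.carrier
  | .var i => v i
  | .compl a => A.compl (A.eval v a)
  | .join a b => A.join (A.eval v a) (A.eval v b)

/-- Truth of a formula under a valuation. -/
def Sat (A : CStructure.{u}) (v : ℕ → A.carrier) : CFormula → Prop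
  | .eq a b => A.eval v a = A.eval v b
  | .contact a b => A.contact (A.eval v a) (A.eval v b)
  | .neg φ => ¬ A.Sat v φ
  | .or φ ψ => A.Sat v φ ∨ A.Sat v ψ

/-- A formula is true in a structure if it is true under every valuation. -/
def IsTrue (A : CStructure.{u}) (φ : CFormula) : Prop := ∀ v : ℕ → A.carrier, A.Sat v φ

/-- The universal fragment of the logic of a structure: the set of the quantifier-free formulas
true in it under all valuations. -/
def universalLogic (A : CStructure.{u}) : Set CFormula := {φ | A.IsTrue φ}

end CStructure

/-! Regularised operations and polytopes. -/

section Topology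

variable {X : Type*} [TopologicalSpace X]

/-- The Boolean complement in the algebra of regular closed sets: `Cl (X \ A)`. -/
def star (A : Set X) : Set X := closure Aᶜ

/-- The regularised intersection of a family of sets: `Cl (Int (⋂ H))`. -/
def regInter (H : Set (Set X)) : Set X := closure (interior (⋂₀ H))

theorem closure_interior_union {A B : Set X} (hA : IsClosed A) :
    closure (interior (A ∪ B)) = closure (interior A) ∪ closure (interior B) := by
  rw [← closure_union]
  apply subset_antisymm
  · apply closure_minimal _ isClosed_closure
    intro x hx
    rw [mem_closure_iff]
    intro U hU hxU
    by_contra hne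
    have hdis : ∀ y ∈ U, y ∉ interior A ∧ y ∉ interior B := by
      intro y hy
      constructor
      · intro h
        exact hne ⟨y, hy, Or.inl h⟩
      · intro h
        exact hne ⟨y, hy, Or.inr h⟩
    have hUA : U ∩ interior (A ∪ B) ⊆ A := by
      intro y hy
      by_contra hyA
      refine (hdis y hy.1).2 (mem_interior.2
        ⟨(U ∩ interior (A ∪ B)) ∩ Aᶜ, ?_,
          (hU.inter isOpen_interior).inter hA.isOpen_compl, hy, hyA⟩)
      rintro z ⟨⟨_, hz⟩, hzA⟩
      exact (interior_subset hz).resolve_left hzA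
    exact (hdis x hxU).1 (mem_interior.2
      ⟨_, hUA, hU.inter isOpen_interior, hxU, hx⟩)
  · exact closure_mono (Set.union_subset (interior_mono Set.subset_union_left)
      (interior_mono Set.subset_union_right))

theorem closure_inter_of_isOpen {U V : Set X} (hU : IsOpen U) (hV : IsOpen V) :
    closure (interior (closure U ∩ closure V)) = closure (U ∩ V) := by
  apply subset_antisymm
  · apply closure_minimal _ isClosed_closure
    intro x hx
    rw [mem_closure_iff]
    intro N hN hxN
    obtain ⟨y, hyN, hyU⟩ := mem_closure_iff.1 (interior_subset hx).1
      (N ∩ interior (closure U ∩ closure V)) (hN.inter isOpen_interior) ⟨hxN, hx⟩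
    obtain ⟨z, hz, hzV⟩ := mem_closure_iff.1 (interior_subset hyN.2).2
      ((N ∩ interior (closure U ∩ closure V)) ∩ U)
      ((hN.inter isOpen_interior).inter hU) ⟨hyN, hyU⟩
    exact ⟨z, hz.1.1, hz.2, hzV⟩
  · exact closure_mono (interior_maximal
      (Set.inter_subset_inter subset_closure subset_closure) (hU.inter hV))

end Topology

/-- The Euclidean space of dimension `n`. -/
abbrev E (n : ℕ) := EuclideanSpace ℝ (Fin n)

variable {n : ℕ}

/-- Closed half-spaces: sets `{x | c ≤ ⟪a, x⟫}` with `a ≠ 0`. -/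
def IsClosedHalfSpace (α : Set (E n)) : Prop :=
  ∃ (a : E n) (c : ℝ), a ≠ 0 ∧ α = {x | c ≤ inner ℝ a x}

/-- Basic polytopes: regularised intersections of finitely many closed half-spaces. -/
def IsBasicPolytope (A : Set (E n)) : Prop :=
  ∃ H : Set (Set (E n)), H.Finite ∧ (∀ α ∈ H, IsClosedHalfSpace α) ∧ A = regInter H

/-- Polytopes: finite unions of basic polytopes. -/
def IsPolytope (A : Set (E n)) : Prop :=
  ∃ B : Set (Set (E n)), B.Finite ∧ (∀ b ∈ B, IsBasicPolytope b) ∧ A = ⋃₀ B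

/-! The polytopes are closed under union and under `star`. -/

theorem IsClosedHalfSpace.isClosed {α : Set (E n)} (h : IsClosedHalfSpace α) : IsClosed α := by
  obtain ⟨a, c, _, rfl⟩ := h
  exact isClosed_le continuous_const (by fun_prop)

theorem star_halfSpace {a : E n} (ha : a ≠ 0) (c : ℝ) :
    star {x : E n | c ≤ inner ℝ a x} = {x | -c ≤ inner ℝ (-a) x} := by
  have hsurj : Function.Surjective (innerSL ℝ a) := by
    intro r
    have hne : inner ℝ a a ≠ (0 : ℝ) := inner_self_ne_zero.2 ha
    refine ⟨(r / inner ℝ a a) • a, ?_⟩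
    rw [innerSL_apply_apply, inner_smul_right]
    field_simp
  have hopen := (innerSL ℝ a).isOpenMap hsurj
  have key := hopen.preimage_closure_eq_closure_preimage (innerSL ℝ a).continuous (Set.Iio c)
  rw [closure_Iio] at key
  have h1 : ({x : E n | c ≤ inner ℝ a x})ᶜ = (innerSL ℝ a) ⁻¹' Set.Iio c := by
    ext x
    simp
  rw [star, h1, ← key]
  ext x
  simp

theorem IsClosedHalfSpace.star {α : Set (E n)} (h : IsClosedHalfSpace α) :
    IsClosedHalfSpace (star α) := by
  obtain ⟨a, c, ha, rfl⟩ := h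
  exact ⟨-a, -c, neg_ne_zero.2 ha, star_halfSpace ha c⟩

theorem IsClosedHalfSpace.closure_interior {α : Set (E n)} (h : IsClosedHalfSpace α) :
    closure (interior α) = α := by
  obtain ⟨a, c, ha, rfl⟩ := h
  have h1 := star_halfSpace (neg_ne_zero.2 ha) (-c)
  rw [← star_halfSpace ha c, neg_neg, neg_neg] at h1
  rw [← h1, ContactLogic.star, ContactLogic.star, ← interior_compl, compl_compl,
    ← h1, ContactLogic.star, ContactLogic.star, ← interior_compl, compl_compl]
  exact closure_interior_idem

theorem IsClosedHalfSpace.isBasicPolytope {α : Set (E n)} (h : IsClosedHalfSpace α) :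
    IsBasicPolytope α := by
  refine ⟨{α}, Set.finite_singleton α, ?_, ?_⟩
  · rintro β rfl
    exact h
  · rw [regInter, Set.sInter_singleton, h.closure_interior]

theorem IsBasicPolytope.isPolytope {A : Set (E n)} (h : IsBasicPolytope A) : IsPolytope A := by
  refine ⟨{A}, Set.finite_singleton A, ?_, (Set.sUnion_singleton A).symm⟩
  rintro b rfl
  exact h

theorem IsPolytope.empty : IsPolytope (∅ : Set (E n)) :=
  ⟨∅, Set.finite_empty, by simp, by simp⟩

theorem IsPolytope.univ : IsPolytope (Set.univ : Set (E n)) :=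
  IsBasicPolytope.isPolytope ⟨∅, Set.finite_empty, by simp, by simp [regInter]⟩

theorem IsPolytope.union {A B : Set (E n)} (hA : IsPolytope A) (hB : IsPolytope B) :
    IsPolytope (A ∪ B) := by
  obtain ⟨S, hS, hSb, rfl⟩ := hA
  obtain ⟨T, hT, hTb, rfl⟩ := hB
  refine ⟨S ∪ T, hS.union hT, ?_, (Set.sUnion_union S T).symm⟩
  rintro b (hb | hb)
  · exact hSb b hb
  · exact hTb b hb

theorem IsPolytope.sUnion {S : Set (Set (E n))} (hS : S.Finite)
    (h : ∀ A ∈ S, IsPolytope A) : IsPolytope (⋃₀ S) := by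
  induction S, hS using Set.Finite.induction_on with
  | empty => simpa using IsPolytope.empty
  | @insert A S _ _ ih =>
    rw [Set.sUnion_insert]
    exact (h A (Set.mem_insert A S)).union
      (ih fun B hB => h B (Set.mem_insert_of_mem A hB))

theorem IsBasicPolytope.isClosed {A : Set (E n)} (h : IsBasicPolytope A) : IsClosed A := by
  obtain ⟨H, _, _, rfl⟩ := h
  exact isClosed_closure

theorem IsPolytope.isClosed {A : Set (E n)} (h : IsPolytope A) : IsClosed A := by
  obtain ⟨S, hS, hSb, rfl⟩ := h
  rw [Set.sUnion_eq_biUnion]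
  exact hS.isClosed_biUnion fun b hb => (hSb b hb).isClosed

theorem IsBasicPolytope.inter {A B : Set (E n)} (hA : IsBasicPolytope A)
    (hB : IsBasicPolytope B) : IsBasicPolytope (closure (interior (A ∩ B))) := by
  obtain ⟨H, hH, hHs, rfl⟩ := hA
  obtain ⟨K, hK, hKs, rfl⟩ := hB
  refine ⟨H ∪ K, hH.union hK, ?_, ?_⟩
  · rintro α (hα | hα)
    · exact hHs α hα
    · exact hKs α hα
  · have hHc : IsClosed (⋂₀ H) := isClosed_sInter fun α hα => (hHs α hα).isClosed
    have hKc : IsClosed (⋂₀ K) := isClosed_sInter fun α hα => (hKs α hα).isClosed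
    rw [regInter, regInter, regInter, closure_inter_of_isOpen isOpen_interior isOpen_interior,
      Set.sInter_union, interior_inter]

theorem IsPolytope.inter {A B : Set (E n)} (hA : IsPolytope A) (hB : IsPolytope B) :
    IsPolytope (closure (interior (A ∩ B))) := by
  have step : ∀ C : Set (E n), IsClosed C → ∀ S : Set (Set (E n)), S.Finite →
      (∀ b ∈ S, IsClosed b ∧ IsPolytope (closure (interior (C ∩ b)))) →
      IsPolytope (closure (interior (C ∩ ⋃₀ S))) := by
    intro C hC S hS
    induction S, hS using Set.Finite.induction_on with
    | empty =>
      intro _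
      simpa using IsPolytope.empty
    | @insert b S _ _ ih =>
      intro h
      rw [Set.sUnion_insert, Set.inter_union_distrib_left,
        closure_interior_union (hC.inter (h b (Set.mem_insert b S)).1)]
      exact (h b (Set.mem_insert b S)).2.union
        (ih fun d hd => h d (Set.mem_insert_of_mem b hd))
  have hAc := hA.isClosed
  obtain ⟨S, hS, hSb, rfl⟩ := hA
  obtain ⟨T, hT, hTb, rfl⟩ := hB
  refine step _ hAc T hT fun t ht => ⟨(hTb t ht).isClosed, ?_⟩
  rw [Set.inter_comm]
  refine step _ (hTb t ht).isClosed S hS fun s hs => ⟨(hSb s hs).isClosed, ?_⟩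
  exact ((hTb t ht).inter (hSb s hs)).isPolytope

theorem IsBasicPolytope.star {A : Set (E n)} (h : IsBasicPolytope A) :
    IsPolytope (star A) := by
  obtain ⟨H, hH, hHs, rfl⟩ := h
  have hc : IsClosed (⋂₀ H) := isClosed_sInter fun α hα => (hHs α hα).isClosed
  have h1 : ContactLogic.star (regInter H) = ⋃₀ (ContactLogic.star '' H) := by
    rw [ContactLogic.star, regInter, ← interior_compl, ← closure_compl]
    have h2 := closure_inter_of_isOpen hc.isOpen_compl hc.isOpen_compl
    rw [Set.inter_self, Set.inter_self] at h2
    rw [h2, Set.compl_sInter, Set.sUnion_image, Set.sUnion_image, hH.closure_biUnion]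
    rfl
  rw [h1]
  refine IsPolytope.sUnion (hH.image _) ?_
  rintro _ ⟨α, hα, rfl⟩
  exact (hHs α hα).star.isBasicPolytope.isPolytope

theorem IsPolytope.star {A : Set (E n)} (h : IsPolytope A) : IsPolytope (star A) := by
  obtain ⟨S, hS, hSb, rfl⟩ := h
  induction S, hS using Set.Finite.induction_on with
  | empty => simpa [ContactLogic.star] using IsPolytope.univ
  | @insert b S _ hS ih =>
    have hb := hSb b (Set.mem_insert b S)
    have hSb' : ∀ d ∈ S, IsBasicPolytope d := fun d hd => hSb d (Set.mem_insert_of_mem b hd)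
    have hcl : IsClosed (⋃₀ S) := by
      rw [Set.sUnion_eq_biUnion]
      exact hS.isClosed_biUnion fun d hd => (hSb' d hd).isClosed
    rw [Set.sUnion_insert, ContactLogic.star, Set.compl_union,
      ← closure_inter_of_isOpen hb.isClosed.isOpen_compl hcl.isOpen_compl]
    exact hb.star.inter (ih hSb')

/-- The algebra `⟨𝒫ⁿ, C⟩` of polytopes in `ℝⁿ`: complement `star`, join `∪`, and the standard
topological contact (non-empty intersection). -/
def polytopeAlgebra (n : ℕ) : CStructure.{0} where
  carrier := {A : Set (E n) // IsPolytope A}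
  nonempty := ⟨⟨∅, IsPolytope.empty⟩⟩
  compl A := ⟨star A.1, A.2.star⟩
  join A B := ⟨A.1 ∪ B.1, A.2.union B.2⟩
  contact A B := (A.1 ∩ B.1).Nonempty

end ContactLogic

/-!
Soundness. Taking interiors embeds the polytopes into the Boolean algebra of regular open sets,
because a polytope is the closure of its interior; this gives the Boolean axioms
(`interiorRegular_eval`). The connectedness axiom holds because Euclidean space is connected
(`polytope_contact_compl`).

Completeness. If `φ` is not provable, Zorn's lemma gives a theory `T` maximal among those omitting
`φ`. The terms modulo equality provable in `T` form a Boolean algebra with a connected contact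
relation, in which exactly the formulas of `T` hold. Only the subalgebra generated by the
variables of `φ` matters. It is finite, so contact is determined by a reflexive symmetric graph on
its atoms (`IsConnectedContact.boolEval_iff`), and the connectedness axiom says that this graph is
connected (`IsConnectedContact.reflTransGen_atom`).

A finite connected graph has a walk that traverses every edge (`exists_path_cover`). Cut the space
by parallel hyperplanes into consecutive slabs, one for each step of the walk, and send an atom to
the union of the slabs at whose steps the walk visits it. Two slabs meet exactly when they are
equal or consecutive (`region_inter_nonempty`), hence the regions of two atoms meet exactly when
the atoms are in contact. This embeds the finite algebra into the polytopes, and the image of the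
canonical valuation refutes `φ` (`exists_not_isTrue`). The slabs exist in every positive dimension,
so the dimension plays no role.
-/

namespace ContactLogic

/-! ### Evaluation of terms in Boolean algebras -/

/-- The value of a term in a Boolean algebra. -/
def boolEval {B : Type*} [BooleanAlgebra B] (v : ℕ → B) : CTerm → B
  | .var i => v i
  | .compl a => (boolEval v a)ᶜ
  | .join a b => boolEval v a ⊔ boolEval v b

section BoolEval

variable {B : Type*} [BooleanAlgebra B] (v : ℕ → B)

theorem boolEval_meet (a b : CTerm) :
    boolEval v (CTerm.meet a b) = boolEval v a ⊓ boolEval v b := by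
  simp [CTerm.meet, boolEval]

theorem boolEval_zero : boolEval v CTerm.zero = ⊥ := by
  rw [CTerm.zero, boolEval_meet]
  exact inf_compl_self _

theorem boolEval_one : boolEval v CTerm.one = ⊤ := by
  rw [CTerm.one, boolEval, boolEval_zero, compl_bot]

end BoolEval

/-! ### Soundness -/

theorem IsPolytope.closure_interior {n : ℕ} {A : Set (E n)} (h : IsPolytope A) :
    closure (interior A) = A := by
  obtain ⟨S, hS, hSb, rfl⟩ := h
  induction S, hS using Set.Finite.induction_on with
  | empty => simp
  | @insert b S _ hS ih =>
    rw [Set.sUnion_insert, closure_interior_union (hSb b (Set.mem_insert b S)).isClosed,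
      ih fun d hd => hSb d (Set.mem_insert_of_mem b hd)]
    obtain ⟨H, -, -, rfl⟩ := hSb b (Set.mem_insert b S)
    rw [regInter, closure_interior_idem]

/-- The interior of a polytope, as an element of the Boolean algebra of regular open sets. -/
def interiorRegular {n : ℕ} (A : (polytopeAlgebra n).carrier) :
    Heyting.Regular (TopologicalSpace.Opens (E n)) :=
  ⟨(⟨A.1ᶜ, A.2.isClosed.isOpen_compl⟩ : TopologicalSpace.Opens (E n))ᶜ,
    Heyting.isRegular_compl _⟩

section InteriorRegular

open TopologicalSpace

variable {n : ℕ}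

theorem coe_interiorRegular (A : (polytopeAlgebra n).carrier) :
    ((interiorRegular A : Opens (E n)) : Set (E n)) = interior A.1 := by
  change (((⟨A.1ᶜ, A.2.isClosed.isOpen_compl⟩ : Opens (E n))ᶜ : Opens (E n)) : Set (E n)) = _
  rw [Opens.coe_compl_eq_interior_compl, Opens.coe_mk, compl_compl]

theorem interiorRegular_injective :
    Function.Injective (interiorRegular : (polytopeAlgebra n).carrier → _) := by
  intro A B h
  apply Subtype.ext
  rw [← A.2.closure_interior, ← B.2.closure_interior, ← coe_interiorRegular,
    ← coe_interiorRegular, h]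

theorem interiorRegular_compl (A : (polytopeAlgebra n).carrier) :
    interiorRegular ((polytopeAlgebra n).compl A) = (interiorRegular A)ᶜ := by
  apply Heyting.Regular.coe_injective
  apply SetLike.coe_injective
  rw [coe_interiorRegular, Heyting.Regular.coe_compl, Opens.coe_compl_eq_interior_compl,
    coe_interiorRegular, ← closure_compl]
  rfl

theorem interiorRegular_join (A B : (polytopeAlgebra n).carrier) :
    interiorRegular ((polytopeAlgebra n).join A B) = interiorRegular A ⊔ interiorRegular B := by
  apply Heyting.Regular.coe_injective
  rw [Heyting.Regular.coe_sup, compl_sup]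
  change _ = (_ᶜᶜ ⊓ _ᶜᶜ)ᶜ
  rw [← compl_compl_inf_distrib, compl_compl_compl]
  apply congrArg compl
  apply SetLike.coe_injective
  exact Set.compl_union _ _

theorem interiorRegular_eval (v : ℕ → (polytopeAlgebra n).carrier) (t : CTerm) :
    interiorRegular ((polytopeAlgebra n).eval v t) =
      boolEval (fun i => interiorRegular (v i)) t := by
  induction t with
  | var i => rfl
  | compl a ih => rw [CStructure.eval, interiorRegular_compl, ih]; rfl
  | join a b iha ihb => rw [CStructure.eval, interiorRegular_join, iha, ihb]; rfl

theorem sat_eq_iff (v : ℕ → (polytopeAlgebra n).carrier) (a b : CTerm) :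
    (polytopeAlgebra n).Sat v (.eq a b) ↔
      boolEval (fun i => interiorRegular (v i)) a =
        boolEval (fun i => interiorRegular (v i)) b := by
  rw [CStructure.Sat, ← interiorRegular_injective.eq_iff, interiorRegular_eval,
    interiorRegular_eval]

theorem coe_eval_zero (v : ℕ → (polytopeAlgebra n).carrier) :
    ((polytopeAlgebra n).eval v CTerm.zero).1 = ∅ := by
  have h : interiorRegular ((polytopeAlgebra n).eval v CTerm.zero) = ⊥ := by
    rw [interiorRegular_eval, boolEval_zero]
  rw [← ((polytopeAlgebra n).eval v CTerm.zero).2.closure_interior, ← coe_interiorRegular, h]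
  simp

theorem coe_eval_one (v : ℕ → (polytopeAlgebra n).carrier) :
    ((polytopeAlgebra n).eval v CTerm.one).1 = Set.univ := by
  change star ((polytopeAlgebra n).eval v CTerm.zero).1 = _
  rw [coe_eval_zero, star, Set.compl_empty, closure_univ]

end InteriorRegular

theorem CStructure.sat_imp (A : CStructure) (v : ℕ → A.carrier) (φ ψ : CFormula) :
    A.Sat v (.imp φ ψ) ↔ (A.Sat v φ → A.Sat v ψ) := by
  simp only [CFormula.imp, CStructure.Sat]
  tauto

theorem CStructure.sat_iff (A : CStructure) (v : ℕ → A.carrier) (φ ψ : CFormula) :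
    A.Sat v (.iff φ ψ) ↔ (A.Sat v φ ↔ A.Sat v ψ) := by
  simp only [CFormula.iff, CFormula.and, CStructure.Sat, CStructure.sat_imp]
  tauto

/-- The connectedness axiom holds since a closed set with empty frontier is `∅` or the whole
space. -/
theorem polytope_contact_compl {n : ℕ} (A : (polytopeAlgebra n).carrier)
    (h0 : A.1 ≠ ∅) (h1 : A.1 ≠ Set.univ) :
    (polytopeAlgebra n).contact A ((polytopeAlgebra n).compl A) := by
  change (A.1 ∩ closure A.1ᶜ).Nonempty
  rw [Set.nonempty_iff_ne_empty]
  intro h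
  have hf : frontier A.1 = ∅ := by
    rw [frontier_eq_closure_inter_closure, A.2.isClosed.closure_eq, h]
  rcases isClopen_iff.1 (isClopen_iff_frontier_eq_empty.2 hf) with h | h
  · exact h0 h
  · exact h1 h

theorem IsAxiom.isTrue {n : ℕ} {φ : CFormula} (h : IsAxiom φ) :
    (polytopeAlgebra n).IsTrue φ := by
  intro v
  cases h with
  | prop_k | prop_s | prop_contra | prop_or_left | prop_or_right | prop_or_elim =>
    simp only [CStructure.sat_imp, CStructure.Sat]
    tauto
  | eq_refl a => rfl
  | eq_symm | eq_trans | eq_compl | eq_join | eq_contact =>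
    simp only [CStructure.sat_imp, CStructure.Sat, CStructure.eval]
    grind
  | join_assoc a b c => rw [sat_eq_iff]; exact (sup_assoc _ _ _).symm
  | meet_assoc a b c => rw [sat_eq_iff]; simp only [boolEval_meet, inf_assoc]
  | join_comm a b => rw [sat_eq_iff]; exact sup_comm _ _
  | meet_comm a b => rw [sat_eq_iff]; simp only [boolEval_meet, inf_comm]
  | join_absorb a b => rw [sat_eq_iff]; simp only [boolEval_meet, boolEval, sup_inf_self]
  | meet_absorb a b => rw [sat_eq_iff]; simp only [boolEval_meet, boolEval, inf_sup_self]
  | meet_distrib a b c => rw [sat_eq_iff]; simp only [boolEval_meet, boolEval, inf_sup_left]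
  | join_distrib a b c => rw [sat_eq_iff]; simp only [boolEval_meet, boolEval, sup_inf_left]
  | join_compl a => rw [sat_eq_iff]; simp only [boolEval_one, boolEval, sup_compl_eq_top]
  | meet_compl a => rw [sat_eq_iff]; simp only [boolEval_meet, boolEval_zero, boolEval,
      inf_compl_self]
  | zero_ne_one =>
    intro h
    have h' := congrArg Subtype.val h
    rw [coe_eval_zero, coe_eval_one] at h'
    exact Set.empty_ne_univ h'
  | contact_zero a =>
    rintro ⟨x, hx, -⟩
    rw [coe_eval_zero] at hx
    exact hx
  | contact_join a b c =>
    rw [CStructure.sat_iff]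
    change Set.Nonempty (_ ∩ (_ ∪ _)) ↔ Set.Nonempty (_ ∩ _) ∨ Set.Nonempty (_ ∩ _)
    rw [Set.inter_union_distrib_left, Set.union_nonempty]
  | contact_symm a b =>
    rw [CStructure.sat_imp]
    rintro ⟨x, hx, hy⟩
    exact ⟨x, hy, hx⟩
  | contact_self a =>
    rw [CStructure.sat_imp]
    intro h
    change Set.Nonempty (_ ∩ _)
    rw [Set.inter_self, Set.nonempty_iff_ne_empty]
    intro h0
    exact h (Subtype.ext (h0.trans (coe_eval_zero v).symm))
  | connected a =>
    rw [CStructure.sat_imp, CStructure.sat_imp]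
    intro h0 h1
    refine polytope_contact_compl _ (fun h => h0 ?_) (fun h => h1 ?_)
    · exact Subtype.ext (h.trans (coe_eval_zero v).symm)
    · exact Subtype.ext (h.trans (coe_eval_one v).symm)

theorem Provable.isTrue {n : ℕ} {φ : CFormula} (h : Provable φ) :
    (polytopeAlgebra n).IsTrue φ := by
  induction h with
  | ax h => exact h.isTrue
  | mp _ _ ih₁ ih₂ => exact fun v => (CStructure.sat_imp _ v _ _).1 (ih₁ v) (ih₂ v)

/-! ### Maximal theories and their contact algebras -/

/-- Sets of formulas containing the axioms and closed under modus ponens. -/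
structure IsTheory (T : Set CFormula) : Prop where
  ax {φ : CFormula} : IsAxiom φ → φ ∈ T
  mp {φ ψ : CFormula} : CFormula.imp φ ψ ∈ T → φ ∈ T → ψ ∈ T

/-- Theories that omit `φ` and are maximal with this property. -/
def IsMaximalTheory (φ : CFormula) (T : Set CFormula) : Prop :=
  Maximal (fun T => IsTheory T ∧ φ ∉ T) T

theorem isTheory_theoremSet : IsTheory theoremSet := ⟨Provable.ax, Provable.mp⟩

theorem exists_isMaximalTheory {φ : CFormula} (h : ¬ Provable φ) :
    ∃ T, IsMaximalTheory φ T := by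
  have key := zorn_subset_nonempty {T | IsTheory T ∧ φ ∉ T} ?_ theoremSet
    ⟨isTheory_theoremSet, h⟩
  · obtain ⟨T, -, hT⟩ := key
    exact ⟨T, hT⟩
  · intro c hc hchain ⟨T₀, hT₀⟩
    refine ⟨⋃₀ c, ⟨⟨fun h => ⟨T₀, hT₀, (hc hT₀).1.ax h⟩, ?_⟩, ?_⟩,
      fun s hs => Set.subset_sUnion_of_mem hs⟩
    · rintro ψ χ ⟨T₁, hT₁, h₁⟩ ⟨T₂, hT₂, h₂⟩
      rcases hchain.total hT₁ hT₂ with hle | hle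
      · exact ⟨T₂, hT₂, (hc hT₂).1.mp (hle h₁) h₂⟩
      · exact ⟨T₁, hT₁, (hc hT₁).1.mp h₁ (hle h₂)⟩
    · rintro ⟨T₁, hT₁, h₁⟩
      exact (hc hT₁).2 h₁

theorem IsTheory.imp_self {T : Set CFormula} (hT : IsTheory T) (ψ : CFormula) :
    CFormula.imp ψ ψ ∈ T :=
  hT.mp (hT.mp (hT.ax (.prop_s ψ (.imp ψ ψ) ψ)) (hT.ax (.prop_k ψ (.imp ψ ψ))))
    (hT.ax (.prop_k ψ ψ))

namespace IsMaximalTheory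

variable {φ : CFormula} {T : Set CFormula}

theorem isTheory (hT : IsMaximalTheory φ T) : IsTheory T := hT.prop.1

/-- The formulas implied by `ψ` modulo `T` form a theory extending `T`; by maximality it
contains `φ` unless `ψ ∈ T`. -/
theorem imp_mem (hT : IsMaximalTheory φ T) {ψ : CFormula} (hψ : ψ ∉ T) :
    CFormula.imp ψ φ ∈ T := by
  have h := hT.isTheory
  by_contra hφ
  have hsub : T ⊆ {χ | CFormula.imp ψ χ ∈ T} := fun χ hχ => h.mp (h.ax (.prop_k χ ψ)) hχ
  have hth : IsTheory {χ | CFormula.imp ψ χ ∈ T} :=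
    ⟨fun hχ => hsub (h.ax hχ), fun h₁ h₂ => h.mp (h.mp (h.ax (.prop_s _ _ _)) h₁) h₂⟩
  exact hψ (hT.le_of_ge ⟨hth, hφ⟩ hsub (h.imp_self ψ))

theorem or_mem_iff (hT : IsMaximalTheory φ T) {ψ χ : CFormula} :
    CFormula.or ψ χ ∈ T ↔ ψ ∈ T ∨ χ ∈ T := by
  have h := hT.isTheory
  constructor
  · intro hor
    by_contra! hn
    exact hT.prop.2 (h.mp (h.mp (h.mp (h.ax (.prop_or_elim ψ χ φ)) (hT.imp_mem hn.1))
      (hT.imp_mem hn.2)) hor)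
  · rintro (hψ | hχ)
    · exact h.mp (h.ax (.prop_or_left _ _)) hψ
    · exact h.mp (h.ax (.prop_or_right _ _)) hχ

theorem neg_mem_iff (hT : IsMaximalTheory φ T) {ψ : CFormula} :
    CFormula.neg ψ ∈ T ↔ ψ ∉ T := by
  have h := hT.isTheory
  constructor
  · intro hn hψ
    exact hT.prop.2 (h.mp (h.mp (h.ax (.prop_or_left (.neg ψ) φ)) hn) hψ)
  · intro hψ
    -- `ψ ⇒ ψ` is by definition the excluded middle `¬ψ ∨ ψ`
    exact (hT.or_mem_iff.1 (h.imp_self ψ)).resolve_right hψ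

theorem imp_mem_iff (hT : IsMaximalTheory φ T) {ψ χ : CFormula} :
    CFormula.imp ψ χ ∈ T ↔ (ψ ∈ T → χ ∈ T) := by
  rw [CFormula.imp, hT.or_mem_iff, hT.neg_mem_iff]
  tauto

theorem iff_mem_iff (hT : IsMaximalTheory φ T) {ψ χ : CFormula} :
    CFormula.iff ψ χ ∈ T ↔ (ψ ∈ T ↔ χ ∈ T) := by
  rw [CFormula.iff, CFormula.and, hT.neg_mem_iff, hT.or_mem_iff, hT.neg_mem_iff,
    hT.neg_mem_iff, hT.imp_mem_iff, hT.imp_mem_iff]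
  tauto

end IsMaximalTheory

/-- Connected contact relations on a Boolean algebra. -/
structure IsConnectedContact {B : Type*} [BooleanAlgebra B] (C : B → B → Prop) : Prop where
  not_bot (a : B) : ¬ C ⊥ a
  sup_right (a b c : B) : C a (b ⊔ c) ↔ C a b ∨ C a c
  symm {a b : B} : C a b → C b a
  self {a : B} : a ≠ ⊥ → C a a
  connected {a : B} : a ≠ ⊥ → a ≠ ⊤ → C a aᶜ

/-- Two terms are identified when the theory proves them equal. -/
def IsTheory.setoid {T : Set CFormula} (hT : IsTheory T) : Setoid CTerm where
  r a b := CFormula.eq a b ∈ T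
  iseqv := ⟨fun a => hT.ax (.eq_refl a), fun h => hT.mp (hT.ax (.eq_symm _ _)) h,
    fun h₁ h₂ => hT.mp (hT.mp (hT.ax (.eq_trans _ _ _)) h₁) h₂⟩

/-- The Lindenbaum algebra of a theory: terms modulo provable equality. -/
def Lindenbaum {T : Set CFormula} (hT : IsTheory T) : Type := Quotient hT.setoid

namespace Lindenbaum

variable {T : Set CFormula} (hT : IsTheory T)

/-- The class of a term. -/
def mk (a : CTerm) : Lindenbaum hT := Quotient.mk hT.setoid a

variable {hT}

theorem mk_eq_mk {a b : CTerm} : mk hT a = mk hT b ↔ CFormula.eq a b ∈ T := Quotient.eq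

theorem ind {p : Lindenbaum hT → Prop} (h : ∀ a, p (mk hT a)) (x : Lindenbaum hT) : p x :=
  Quotient.ind h x

theorem mk_surjective : Function.Surjective (mk hT) := Quotient.mk_surjective

section Operations

/-- Complementation of classes. -/
@[reducible] def instCompl : Compl (Lindenbaum hT) :=
  ⟨Quotient.map CTerm.compl fun _ _ h => hT.mp (hT.ax (.eq_compl _ _)) h⟩

/-- Joins of classes. -/
@[reducible] def instMax : Max (Lindenbaum hT) :=
  ⟨Quotient.map₂ CTerm.join fun _ _ h₁ _ _ h₂ =>
    hT.mp (hT.mp (hT.ax (.eq_join _ _ _ _)) h₁) h₂⟩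

attribute [local instance] instCompl instMax

/-- Meets of classes. -/
@[reducible] def instMin : Min (Lindenbaum hT) := ⟨fun a b => (aᶜ ⊔ bᶜ)ᶜ⟩

attribute [local instance] instMin

theorem mk_eq_of_isAxiom {a b : CTerm} (h : IsAxiom (.eq a b)) : mk hT a = mk hT b :=
  mk_eq_mk.2 (hT.ax h)

/-- The lattice of classes. -/
@[reducible] def instLattice : Lattice (Lindenbaum hT) :=
  Lattice.mk'
    (ind fun a => ind fun b => mk_eq_of_isAxiom (.join_comm a b))
    (ind fun a => ind fun b => ind fun c => (mk_eq_of_isAxiom (.join_assoc a b c)).symm)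
    (ind fun a => ind fun b => mk_eq_of_isAxiom (.meet_comm a b))
    (ind fun a => ind fun b => ind fun c => (mk_eq_of_isAxiom (.meet_assoc a b c)).symm)
    (ind fun a => ind fun b => mk_eq_of_isAxiom (.join_absorb a b))
    (ind fun a => ind fun b => mk_eq_of_isAxiom (.meet_absorb a b))

theorem inf_compl (x : Lindenbaum hT) : x ⊓ xᶜ = mk hT .zero :=
  ind (p := fun x => x ⊓ xᶜ = mk hT .zero) (fun a => mk_eq_of_isAxiom (.meet_compl a)) x

theorem sup_compl (x : Lindenbaum hT) : x ⊔ xᶜ = mk hT .one :=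
  ind (p := fun x => x ⊔ xᶜ = mk hT .one) (fun a => mk_eq_of_isAxiom (.join_compl a)) x

instance : BooleanAlgebra (Lindenbaum hT) where
  __ := instLattice
  le_sup_inf := ind fun a => ind fun b => ind fun c =>
    (mk_eq_of_isAxiom (.join_distrib a b c)).ge
  bot := mk hT .zero
  top := mk hT .one
  bot_le x := (inf_compl x).symm.le.trans inf_le_left
  le_top x := le_sup_left.trans (sup_compl x).le
  inf_compl_le_bot x := (inf_compl x).le
  top_le_sup_compl x := (sup_compl x).ge

end Operations

theorem mk_join (a b : CTerm) : mk hT (.join a b) = mk hT a ⊔ mk hT b := rfl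

theorem mk_compl (a : CTerm) : mk hT (.compl a) = (mk hT a)ᶜ := rfl

theorem mk_zero : mk hT .zero = ⊥ := rfl

theorem mk_one : mk hT .one = ⊤ := rfl

theorem boolEval_mk (a : CTerm) : boolEval (fun i => mk hT (.var i)) a = mk hT a := by
  induction a with
  | var i => rfl
  | compl a ih => rw [boolEval, ih, mk_compl]
  | join a b iha ihb => rw [boolEval, iha, ihb, mk_join]

/-- The contact relation on the Lindenbaum algebra. -/
def contact (hT : IsTheory T) : Lindenbaum hT → Lindenbaum hT → Prop :=
  Quotient.lift₂ (fun a b => CFormula.contact a b ∈ T) fun _ _ _ _ h₁ h₂ =>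
    propext ⟨fun h => hT.mp (hT.mp (hT.mp (hT.ax (.eq_contact _ _ _ _)) h₁) h₂) h,
      fun h => hT.mp (hT.mp (hT.mp (hT.ax (.eq_contact _ _ _ _)) (hT.setoid.symm h₁))
        (hT.setoid.symm h₂)) h⟩

theorem contact_mk {a b : CTerm} :
    contact hT (mk hT a) (mk hT b) ↔ CFormula.contact a b ∈ T := Iff.rfl

end Lindenbaum

open Lindenbaum in
theorem IsMaximalTheory.isConnectedContact {φ : CFormula} {T : Set CFormula}
    (hT : IsMaximalTheory φ T) : IsConnectedContact (Lindenbaum.contact hT.isTheory) where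
  not_bot := ind fun a => hT.neg_mem_iff.1 (hT.isTheory.ax (.contact_zero a))
  sup_right := ind fun a => ind fun b => ind fun c => by
    rw [← mk_join, contact_mk, contact_mk, contact_mk, ← hT.or_mem_iff]
    exact hT.iff_mem_iff.1 (hT.isTheory.ax (.contact_join a b c))
  symm {x y} := by
    obtain ⟨a, rfl⟩ := mk_surjective x
    obtain ⟨b, rfl⟩ := mk_surjective y
    exact hT.imp_mem_iff.1 (hT.isTheory.ax (.contact_symm a b))
  self {x} := by
    obtain ⟨a, rfl⟩ := mk_surjective x
    rw [← mk_zero, Ne, mk_eq_mk, ← hT.neg_mem_iff]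
    exact hT.imp_mem_iff.1 (hT.isTheory.ax (.contact_self a))
  connected {x} := by
    obtain ⟨a, rfl⟩ := mk_surjective x
    rw [← mk_zero, ← mk_one, Ne, Ne, mk_eq_mk, mk_eq_mk, ← hT.neg_mem_iff, ← hT.neg_mem_iff]
    intro h0 h1
    exact hT.isTheory.mp (hT.isTheory.mp (hT.isTheory.ax (.connected a)) h0) h1

/-! ### Atoms of a finitely generated subalgebra -/

/-- The variables of a term. -/
def CTerm.vars : CTerm → Finset ℕ
  | .var i => {i}
  | .compl a => a.vars
  | .join a b => a.vars ∪ b.vars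

/-- The variables of a formula. -/
def CFormula.vars : CFormula → Finset ℕ
  | .eq a b => a.vars ∪ b.vars
  | .contact a b => a.vars ∪ b.vars
  | .neg φ => φ.vars
  | .or φ ψ => φ.vars ∪ ψ.vars

/-- `t` evaluates to true when exactly the variables in `s` are true. -/
def CTerm.Holds (s : Finset ℕ) (t : CTerm) : Prop := boolEval (fun k => k ∈ s) t

/-- Evaluating in an algebra of sets is evaluating truth values pointwise. -/
theorem boolEval_set_iff {ι : Type*} (s : ι → Finset ℕ) (i : ι) (t : CTerm) :
    i ∈ boolEval (fun k => {i | k ∈ s i}) t ↔ t.Holds (s i) := by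
  induction t with
  | var k => rfl
  | compl a ih => exact not_congr ih
  | join a b iha ihb => exact or_congr iha ihb

/-- The meet of the literals over the variables in `S`, those in `s` positive and the others
negative. -/
def atom {B : Type*} [BooleanAlgebra B] (v : ℕ → B) (S s : Finset ℕ) : B :=
  S.inf fun k => if k ∈ s then v k else (v k)ᶜ

section Atom

variable {B : Type*} [BooleanAlgebra B] {v : ℕ → B} {S : Finset ℕ}

theorem atom_le_var {s : Finset ℕ} {k : ℕ} (hk : k ∈ S) (hs : k ∈ s) : atom v S s ≤ v k :=
  (Finset.inf_le hk).trans (if_pos hs).le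

theorem atom_le_compl_var {s : Finset ℕ} {k : ℕ} (hk : k ∈ S) (hs : k ∉ s) :
    atom v S s ≤ (v k)ᶜ :=
  (Finset.inf_le hk).trans (if_neg hs).le

theorem atom_insert (k : ℕ) (s : Finset ℕ) :
    atom v (insert k S) s = (if k ∈ s then v k else (v k)ᶜ) ⊓ atom v S s := by
  rw [atom, Finset.inf_insert]
  rfl

theorem atom_insert_right {k : ℕ} (hk : k ∉ S) (s : Finset ℕ) :
    atom v S (insert k s) = atom v S s := by
  refine Finset.inf_congr rfl fun j hj => ?_
  have hjk : j ≠ k := fun h => hk (h ▸ hj)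
  simp [hjk]

/-- The atoms cover the algebra, in the form in which this is used: a property that passes from
a join to one of its parts passes from `b` to the part of `b` below some atom. -/
theorem exists_inf_atom {P : B → Prop} (hP : ∀ x y, P (x ⊔ y) → P x ∨ P y) {b : B} (hb : P b) :
    ∃ s ⊆ S, P (b ⊓ atom v S s) := by
  induction S using Finset.induction_on with
  | empty => exact ⟨∅, subset_rfl, by simpa [atom] using hb⟩
  | insert k S hk ih =>
    obtain ⟨s, hs, h⟩ := ih
    rw [← sup_inf_inf_compl (x := b ⊓ atom v S s) (y := v k)] at h
    rcases hP _ _ h with h | h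
    · refine ⟨insert k s, Finset.insert_subset_insert k hs, ?_⟩
      rwa [atom_insert k, atom_insert_right hk, if_pos (Finset.mem_insert_self k s),
        inf_comm (v k), ← inf_assoc]
    · refine ⟨s, hs.trans (Finset.subset_insert k S), ?_⟩
      rwa [atom_insert k, if_neg fun h => hk (hs h), inf_comm (v k)ᶜ, ← inf_assoc]

/-- An atom decides every term in the variables `S`, according to its truth value. -/
theorem atom_le_boolEval (s : Finset ℕ) {t : CTerm} (ht : t.vars ⊆ S) :
    (t.Holds s → atom v S s ≤ boolEval v t) ∧ (¬ t.Holds s → atom v S s ≤ (boolEval v t)ᶜ) := by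
  induction t with
  | var k =>
    have hk : k ∈ S := ht (Finset.mem_singleton_self k)
    exact ⟨fun h => atom_le_var hk h, fun h => atom_le_compl_var hk h⟩
  | compl a ih =>
    obtain ⟨h₁, h₂⟩ := ih ht
    refine ⟨h₂, fun h => (h₁ (not_not.1 h)).trans ?_⟩
    rw [boolEval, compl_compl]
  | join a b iha ihb =>
    obtain ⟨ha₁, ha₂⟩ := iha (Finset.union_subset_left ht)
    obtain ⟨hb₁, hb₂⟩ := ihb (Finset.union_subset_right ht)
    constructor
    · rintro (h | h)
      · exact (ha₁ h).trans le_sup_left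
      · exact (hb₁ h).trans le_sup_right
    · intro h
      obtain ⟨h₁, h₂⟩ := not_or.1 h
      rw [boolEval, compl_sup]
      exact le_inf (ha₂ h₁) (hb₂ h₂)

theorem disjoint_atom {s s' : Finset ℕ} (hs : s ⊆ S) (hs' : s' ⊆ S) (h : s ≠ s') :
    Disjoint (atom v S s) (atom v S s') := by
  obtain ⟨k, hk⟩ : ∃ k, ¬ (k ∈ s ↔ k ∈ s') := by
    by_contra! hne
    exact h (Finset.ext hne)
  by_cases hks : k ∈ s
  · exact disjoint_compl_right.mono (atom_le_var (hs hks) hks)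
      (atom_le_compl_var (hs hks) fun h => hk (iff_of_true hks h))
  · have hks' : k ∈ s' := by tauto
    exact disjoint_compl_left.mono (atom_le_compl_var (hs' hks') hks)
      (atom_le_var (hs' hks') hks')

variable (v S) in
/-- The nonzero atoms of the subalgebra generated by `v k`, `k ∈ S`, each represented by its set
of positive variables. -/
abbrev AtomIndex : Type := {s : Finset ℕ // s ⊆ S ∧ atom v S s ≠ ⊥}

instance : Finite (AtomIndex v S) :=
  have hsub : {s | s ⊆ S ∧ atom v S s ≠ ⊥} ⊆ Set.Iic S := fun _ h => h.1
  ((Set.finite_Iic S).subset hsub).to_subtype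

theorem boolEval_le_iff {a b : CTerm} (ha : a.vars ⊆ S) (hb : b.vars ⊆ S) :
    boolEval v a ≤ boolEval v b ↔ ∀ w : AtomIndex v S, a.Holds w.1 → b.Holds w.1 := by
  constructor
  · intro h w hw
    by_contra hn
    exact w.2.2 (disjoint_self.1 (disjoint_compl_right.mono
      (((atom_le_boolEval w.1 ha).1 hw).trans h) ((atom_le_boolEval w.1 hb).2 hn)))
  · intro h
    by_contra hn
    have hne : boolEval v a ⊓ (boolEval v b)ᶜ ≠ ⊥ := by
      rwa [Ne, ← disjoint_iff, disjoint_compl_right_iff]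
    obtain ⟨s, hs, hs0⟩ := exists_inf_atom (v := v) (S := S) (P := (· ≠ ⊥))
      (fun x y hxy => by simpa [or_iff_not_imp_left] using hxy) hne
    have hsa : atom v S s ≠ ⊥ := fun h0 => hs0 (by rw [h0, inf_bot_eq])
    by_cases hH : a.Holds s
    · have := (atom_le_boolEval (v := v) s hb).1 (h ⟨s, hs, hsa⟩ hH)
      exact hs0 (disjoint_iff.1 (disjoint_compl_left.mono inf_le_right this))
    · have := (atom_le_boolEval (v := v) s ha).2 hH
      exact hs0 (disjoint_iff.1 (disjoint_compl_right.mono inf_le_left this))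

theorem boolEval_eq_iff {a b : CTerm} (ha : a.vars ⊆ S) (hb : b.vars ⊆ S) :
    boolEval v a = boolEval v b ↔ ∀ w : AtomIndex v S, a.Holds w.1 ↔ b.Holds w.1 := by
  rw [le_antisymm_iff, boolEval_le_iff ha hb, boolEval_le_iff hb ha, ← forall_and]
  exact forall_congr' fun w => iff_def.symm

end Atom

namespace IsConnectedContact

variable {B : Type*} [BooleanAlgebra B] {C : B → B → Prop} (hC : IsConnectedContact C)
  {v : ℕ → B} {S : Finset ℕ}

include hC

theorem mono_right {a b b' : B} (hb : b ≤ b') (h : C a b) : C a b' := by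
  rw [← sup_eq_right.2 hb]
  exact (hC.sup_right a b b').2 (Or.inl h)

theorem mono {a a' b b' : B} (ha : a ≤ a') (hb : b ≤ b') (h : C a b) : C a' b' :=
  hC.symm (hC.mono_right ha (hC.symm (hC.mono_right hb h)))

theorem left_ne_bot {a b : B} (h : C a b) : a ≠ ⊥ := fun h0 => hC.not_bot b (h0 ▸ h)

/-- Elements in contact have parts in contact that lie below nonzero atoms. -/
theorem exists_inf_atom {a b : B} (h : C a b) :
    ∃ w w' : AtomIndex v S, C (a ⊓ atom v S w.1) (b ⊓ atom v S w'.1) := by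
  obtain ⟨s', hs', h'⟩ := ContactLogic.exists_inf_atom (v := v) (S := S) (P := C a)
    (fun x y => (hC.sup_right a x y).1) h
  obtain ⟨s, hs, h''⟩ := ContactLogic.exists_inf_atom (v := v) (S := S)
    (P := C (b ⊓ atom v S s')) (fun x y => (hC.sup_right _ x y).1) (hC.symm h')
  have hne := hC.left_ne_bot h''
  have hne' := hC.left_ne_bot (hC.symm h'')
  exact ⟨⟨s, hs, fun h0 => hne' (by rw [h0, inf_bot_eq])⟩,
    ⟨s', hs', fun h0 => hne (by rw [h0, inf_bot_eq])⟩, hC.symm h''⟩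

theorem boolEval_iff {a b : CTerm} (ha : a.vars ⊆ S) (hb : b.vars ⊆ S) :
    C (boolEval v a) (boolEval v b) ↔ ∃ w w' : AtomIndex v S,
      C (atom v S w.1) (atom v S w'.1) ∧ a.Holds w.1 ∧ b.Holds w'.1 := by
  constructor
  · intro h
    obtain ⟨w, w', hw⟩ := hC.exists_inf_atom (v := v) (S := S) h
    refine ⟨w, w', hC.mono inf_le_right inf_le_right hw, ?_, ?_⟩
    · by_contra hn
      exact hC.left_ne_bot hw (disjoint_iff.1
        (disjoint_compl_right.mono_right ((atom_le_boolEval w.1 ha).2 hn)))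
    · by_contra hn
      exact hC.left_ne_bot (hC.symm hw) (disjoint_iff.1
        (disjoint_compl_right.mono_right ((atom_le_boolEval w'.1 hb).2 hn)))
  · rintro ⟨w, w', h, hwa, hwb⟩
    exact hC.mono ((atom_le_boolEval w.1 ha).1 hwa) ((atom_le_boolEval w'.1 hb).1 hwb) h

/-- The contact graph on the nonzero atoms is connected: the join of the atoms reachable from
`w` is not in contact with its complement, so it is the top element. -/
theorem reflTransGen_atom (w w' : AtomIndex v S) :
    Relation.ReflTransGen (fun w w' : AtomIndex v S => C (atom v S w.1) (atom v S w'.1))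
      w w' := by
  classical
  have := Fintype.ofFinite (AtomIndex v S)
  set R := fun w w' : AtomIndex v S => C (atom v S w.1) (atom v S w'.1)
  by_contra hw'
  set a : B := (Finset.univ.filter (Relation.ReflTransGen R w)).sup
    (fun u : AtomIndex v S => atom v S u.1)
  have hle : ∀ u, Relation.ReflTransGen R w u → atom v S u.1 ≤ a := fun u hu =>
    Finset.le_sup (f := fun u : AtomIndex v S => atom v S u.1)
      (Finset.mem_filter.2 ⟨Finset.mem_univ u, hu⟩)
  have hdis : ∀ u, ¬ Relation.ReflTransGen R w u → Disjoint a (atom v S u.1) := by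
    intro u hu
    rw [Finset.disjoint_sup_left]
    intro x hx
    refine disjoint_atom x.2.1 u.2.1 fun hxu => hu ?_
    rw [← Subtype.ext (a1 := x) (a2 := u) hxu]
    exact (Finset.mem_filter.1 hx).2
  have h0 : a ≠ ⊥ := fun h => w.2.2 (le_bot_iff.1 ((hle w .refl).trans h.le))
  have h1 : a ≠ ⊤ := fun h => w'.2.2 (top_disjoint.1 ((hdis w' hw').mono_left h.ge))
  obtain ⟨x, y, hxy⟩ := hC.exists_inf_atom (v := v) (S := S) (hC.connected h0 h1)
  have hx : Relation.ReflTransGen R w x := by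
    by_contra hx
    exact hC.left_ne_bot hxy (disjoint_iff.1 (hdis x hx))
  refine hC.left_ne_bot (hC.symm hxy)
    (disjoint_iff.1 (disjoint_compl_left.mono_right (hle y (hx.tail ?_))))
  exact hC.mono inf_le_right inf_le_right hxy

end IsConnectedContact

/-! ### Walks through all the edges of a connected graph -/

/-- The walk is built backwards: to add the edge from `w` to `w'`, put it and a walk from `w'` to
the start of the old walk in front. -/
theorem exists_isChain_forall_isInfix {W : Type*} [Finite W] [Nonempty W] {R : W → W → Prop}
    (hrefl : ∀ w, R w w) (hconn : ∀ w w', Relation.ReflTransGen R w w') :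
    ∃ l : List W, l.IsChain R ∧ ∀ w w', R w w' → [w, w'] <:+: l := by
  classical
  have := Fintype.ofFinite W
  suffices h : ∀ F : Finset (W × W), ∃ (t : W) (l : List W), (t :: l).IsChain R ∧
      ∀ e ∈ F, R e.1 e.2 → [e.1, e.2] <:+: t :: l by
    obtain ⟨t, l, hl, h⟩ := h Finset.univ
    exact ⟨t :: l, hl, fun w w' => h (w, w') (Finset.mem_univ _)⟩
  intro F
  induction F using Finset.induction_on with
  | empty => exact ⟨Classical.arbitrary W, [], List.isChain_singleton _, by simp⟩
  | insert e F he ih =>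
    obtain ⟨t, l, hl, hF⟩ := ih
    by_cases hR : R e.1 e.2
    · obtain ⟨l', hl', hlast⟩ := List.exists_isChain_cons_of_relationReflTransGen (hconn e.2 t)
      refine ⟨e.1, (e.2 :: l') ++ (t :: l), ?_, ?_⟩
      · rw [List.cons_append, List.isChain_cons_cons, ← List.cons_append]
        refine ⟨hR, List.isChain_append.2 ⟨hl', hl, ?_⟩⟩
        intro x hx y hy
        rw [List.getLast?_eq_getLast_of_ne_nil (List.cons_ne_nil _ _), hlast] at hx
        simp only [Option.mem_def, Option.some.injEq, List.head?_cons] at hx hy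
        -- the connecting walk ends where the old one starts, and this vertex is repeated
        subst hx hy
        exact hrefl _
      · intro d hd hRd
        rcases Finset.mem_insert.1 hd with rfl | hd
        · exact ⟨[], l' ++ t :: l, by simp⟩
        · exact (hF d hd hRd).trans ⟨e.1 :: e.2 :: l', [], by simp⟩
    · refine ⟨t, l, hl, fun d hd hRd => ?_⟩
      rcases Finset.mem_insert.1 hd with rfl | hd
      · exact absurd hRd hR
      · exact hF d hd hRd

/-- A finite connected reflexive graph is the image of a path `0, …, N` with `0 < N`, by a map
under which two vertices are adjacent exactly when they have preimages at distance at most one. -/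
theorem exists_path_cover {W : Type*} [Finite W] [Nonempty W] {R : W → W → Prop}
    (hrefl : ∀ w, R w w) (hsymm : ∀ w w', R w w' → R w' w)
    (hconn : ∀ w w', Relation.ReflTransGen R w w') :
    ∃ N : ℕ, 0 < N ∧ ∃ p : Fin (N + 1) → W, ∀ w w', R w w' ↔
      ∃ i j : Fin (N + 1), (i : ℕ) ≤ j + 1 ∧ (j : ℕ) ≤ i + 1 ∧ p i = w ∧ p j = w' := by
  obtain ⟨l, hl, hinf⟩ := exists_isChain_forall_isInfix hrefl hconn
  have hlen : 2 ≤ l.length := by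
    obtain ⟨w⟩ := ‹Nonempty W›
    exact (hinf w w (hrefl w)).length_le
  have hN : l.length - 1 + 1 = l.length := by omega
  refine ⟨l.length - 1, by omega, fun i => l[i.1]'(by omega), fun w w' => ⟨fun h => ?_, ?_⟩⟩
  · obtain ⟨l₁, l₂, h'⟩ := hinf w w' h
    have hlen' : l.length = l₁.length + 2 + l₂.length := by rw [← h']; simp; omega
    refine ⟨⟨l₁.length, by omega⟩, ⟨l₁.length + 1, by omega⟩, by simp; omega, by simp, ?_, ?_⟩
    · simp [← h']
    · simp [← h']
  · rintro ⟨i, j, hij, hji, rfl, rfl⟩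
    have hstep := List.isChain_iff_getElem.1 hl
    rcases lt_trichotomy i.1 j.1 with h | h | h
    · have h' : j.1 = i.1 + 1 := by omega
      simp only [h']
      exact hstep i.1 (by omega)
    · simp only [h]
      exact hrefl _
    · have h' : i.1 = j.1 + 1 := by omega
      simp only [h']
      exact hsymm _ _ (hstep j.1 (by omega))

/-! ### Dividing the space into parallel slabs -/

/-- The interval number `i` of the subdivision of the line by the points `1, …, N`: it is
`[i, i + 1]`, except that the first and the last one are half-lines. -/
def cell (N i : ℕ) : Set ℝ :=
  if i = 0 then Set.Iic 1 else if i = N then Set.Ici (N : ℝ) else Set.Icc (i : ℝ) (i + 1)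

theorem closure_interior_cell (N i : ℕ) : closure (interior (cell N i)) = cell N i := by
  unfold cell
  split_ifs
  · simp
  · simp
  · rw [interior_Icc, closure_Ioo (by simp)]

theorem mem_cell {N i : ℕ} {r : ℝ} (h₁ : (i : ℝ) ≤ r) (h₂ : r ≤ i + 1) : r ∈ cell N i := by
  unfold cell
  split_ifs with h h'
  · subst h
    simpa using h₂
  · subst h'
    exact h₁
  · exact ⟨h₁, h₂⟩

theorem left_le_of_mem_cell {N i : ℕ} {r : ℝ} (hi : i ≠ 0) (h : r ∈ cell N i) : (i : ℝ) ≤ r := by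
  unfold cell at h
  rw [if_neg hi] at h
  split_ifs at h with h'
  · subst h'
    exact h
  · exact h.1

theorem le_right_of_mem_cell {N i : ℕ} {r : ℝ} (hi : i < N) (h : r ∈ cell N i) :
    r ≤ (i + 1 : ℕ) := by
  unfold cell at h
  split_ifs at h with h' h''
  · subst h'
    simpa using h
  · omega
  · exact_mod_cast h.2

theorem cell_inter_cell_nonempty {N i j : ℕ} (hi : i ≤ N) (hj : j ≤ N) :
    (cell N i ∩ cell N j).Nonempty ↔ i ≤ j + 1 ∧ j ≤ i + 1 := by
  have hiN : (i : ℝ) ≤ N := by exact_mod_cast hi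
  have hjN : (j : ℝ) ≤ N := by exact_mod_cast hj
  constructor
  · rintro ⟨r, hri, hrj⟩
    have key : ∀ {k l : ℕ}, k ≤ N → l ≤ N → r ∈ cell N k → r ∈ cell N l → k ≤ l + 1 := by
      intro k l hk hl hrk hrl
      by_contra! hlt
      have h₁ := left_le_of_mem_cell (by omega) hrk
      have h₂ := le_right_of_mem_cell (by omega) hrl
      exact absurd (h₁.trans h₂) (by exact_mod_cast not_le.2 hlt)
    exact ⟨key hi hj hri hrj, key hj hi hrj hri⟩
  · rintro ⟨h₁, h₂⟩
    -- consecutive intervals share the left end of the second one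
    rcases lt_trichotomy i j with h | rfl | h
    · obtain rfl : j = i + 1 := by omega
      refine ⟨(i + 1 : ℕ), mem_cell ?_ ?_, mem_cell ?_ ?_⟩ <;> push_cast <;> linarith
    · exact ⟨i, mem_cell le_rfl (by linarith), mem_cell le_rfl (by linarith)⟩
    · obtain rfl : i = j + 1 := by omega
      refine ⟨(j + 1 : ℕ), mem_cell ?_ ?_, mem_cell ?_ ?_⟩ <;> push_cast <;> linarith

theorem disjoint_interior_cell {N i j : ℕ} (hi : i ≤ N) (hj : j ≤ N) (hij : i ≠ j) :
    Disjoint (interior (cell N i)) (cell N j) := by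
  rw [Set.disjoint_left]
  intro r hri hrj
  rcases lt_or_gt_of_ne hij with h | h
  · have h₁ : (j : ℝ) ≤ r := left_le_of_mem_cell (by omega) hrj
    have h₂ : r < (i + 1 : ℕ) := by
      have hsub : cell N i ⊆ Set.Iic ((i + 1 : ℕ) : ℝ) := fun s hs =>
        le_right_of_mem_cell (by omega) hs
      have := interior_mono hsub hri
      rwa [interior_Iic] at this
    exact absurd (h₁.trans_lt h₂) (by exact_mod_cast not_lt.2 h)
  · have h₁ : r ≤ (j + 1 : ℕ) := le_right_of_mem_cell (by omega) hrj
    have h₂ : (i : ℝ) < r := by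
      have hsub : cell N i ⊆ Set.Ici (i : ℝ) := fun s hs => left_le_of_mem_cell (by omega) hs
      have := interior_mono hsub hri
      rwa [interior_Ici] at this
    exact absurd (h₂.trans_le h₁) (by exact_mod_cast not_lt.2 h)

theorem exists_mem_cell {N : ℕ} (hN : 0 < N) (r : ℝ) : ∃ i ≤ N, r ∈ cell N i := by
  rcases le_total r 1 with h | h
  · exact ⟨0, N.zero_le, by simpa [cell] using h⟩
  rcases le_total (N : ℝ) r with h' | h'
  · exact ⟨N, le_rfl, by simpa [cell, hN.ne'] using h'⟩
  · have hr : 0 ≤ r := zero_le_one.trans h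
    exact ⟨⌊r⌋₊, Nat.floor_le_of_le h', mem_cell (Nat.floor_le hr) (Nat.lt_floor_add_one r).le⟩

section Region

variable {n : ℕ} {a : E n} {N : ℕ}

theorem innerSL_surjective (ha : a ≠ 0) : Function.Surjective (innerSL ℝ a) := by
  intro r
  have hne : inner ℝ a a ≠ (0 : ℝ) := inner_self_ne_zero.2 ha
  refine ⟨(r / inner ℝ a a) • a, ?_⟩
  rw [innerSL_apply_apply, inner_smul_right]
  field_simp

theorem isOpenMap_innerSL (ha : a ≠ 0) : IsOpenMap (innerSL ℝ a) :=
  (innerSL ℝ a).isOpenMap (innerSL_surjective ha)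

theorem interior_preimage_innerSL (ha : a ≠ 0) (s : Set ℝ) :
    interior (innerSL ℝ a ⁻¹' s) = innerSL ℝ a ⁻¹' interior s :=
  ((isOpenMap_innerSL ha).preimage_interior_eq_interior_preimage
    (innerSL ℝ a).continuous s).symm

theorem closure_preimage_innerSL (ha : a ≠ 0) (s : Set ℝ) :
    closure (innerSL ℝ a ⁻¹' s) = innerSL ℝ a ⁻¹' closure s :=
  ((isOpenMap_innerSL ha).preimage_closure_eq_closure_preimage
    (innerSL ℝ a).continuous s).symm

theorem isPolytope_preimage_cell (ha : a ≠ 0) (i : ℕ) :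
    IsPolytope (innerSL ℝ a ⁻¹' cell N i) := by
  have hge : ∀ c : ℝ, IsClosedHalfSpace (innerSL ℝ a ⁻¹' Set.Ici c) := fun c => ⟨a, c, ha, rfl⟩
  have hle : ∀ c : ℝ, IsClosedHalfSpace (innerSL ℝ a ⁻¹' Set.Iic c) := fun c =>
    ⟨-a, -c, neg_ne_zero.2 ha, by ext x; simp⟩
  rw [← closure_interior_cell, ← closure_preimage_innerSL ha, ← interior_preimage_innerSL ha]
  unfold cell
  split_ifs
  · rw [(hle 1).closure_interior]
    exact (hle 1).isBasicPolytope.isPolytope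
  · rw [(hge N).closure_interior]
    exact (hge N).isBasicPolytope.isPolytope
  · rw [← Set.Ici_inter_Iic, Set.preimage_inter]
    exact (hge _).isBasicPolytope.isPolytope.inter (hle _).isBasicPolytope.isPolytope

variable (a N) in
/-- The union of the slabs, orthogonal to `a`, over the intervals with numbers in `K`. -/
def region (K : Set (Fin (N + 1))) : Set (E n) := ⋃ i ∈ K, innerSL ℝ a ⁻¹' cell N i

theorem isPolytope_region (ha : a ≠ 0) (K : Set (Fin (N + 1))) : IsPolytope (region a N K) := by
  rw [region, ← Set.sUnion_image]
  refine IsPolytope.sUnion (K.toFinite.image _) ?_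
  rintro _ ⟨i, -, rfl⟩
  exact isPolytope_preimage_cell ha i

theorem region_union (K L : Set (Fin (N + 1))) :
    region a N (K ∪ L) = region a N K ∪ region a N L :=
  Set.biUnion_union K L _

theorem disjoint_interior_region (ha : a ≠ 0) {K : Set (Fin (N + 1))} {i : Fin (N + 1)}
    (hi : i ∉ K) : Disjoint (interior (innerSL ℝ a ⁻¹' cell N i)) (region a N K) := by
  rw [region, Set.disjoint_iUnion₂_right]
  intro j hj
  rw [interior_preimage_innerSL ha]
  exact (disjoint_interior_cell (Nat.lt_succ_iff.1 i.2) (Nat.lt_succ_iff.1 j.2)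
    fun h => hi (Fin.ext h ▸ hj)).preimage _

theorem star_region (ha : a ≠ 0) (hN : 0 < N) (K : Set (Fin (N + 1))) :
    star (region a N K) = region a N Kᶜ := by
  apply subset_antisymm
  · refine closure_minimal (fun x hx => ?_) (isPolytope_region ha Kᶜ).isClosed
    obtain ⟨i, hi, hxi⟩ := exists_mem_cell hN (innerSL ℝ a x)
    refine Set.mem_biUnion (x := (⟨i, Nat.lt_succ_iff.2 hi⟩ : Fin (N + 1))) ?_ hxi
    exact fun hK => hx (Set.mem_biUnion hK hxi)
  · refine Set.iUnion₂_subset fun i hi => ?_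
    rw [← closure_interior_cell, ← closure_preimage_innerSL ha, ← interior_preimage_innerSL ha]
    exact closure_mono (disjoint_interior_region ha hi).subset_compl_right

theorem region_injective (ha : a ≠ 0) : Function.Injective (region a N) := by
  have key : ∀ K L, region a N K ⊆ region a N L → K ⊆ L := by
    intro K L h i hi
    by_contra hiL
    obtain ⟨r, hr⟩ : (interior (cell N i)).Nonempty := by
      rw [← closure_nonempty_iff, closure_interior_cell]
      exact ⟨i, mem_cell le_rfl (by linarith)⟩
    obtain ⟨x, rfl⟩ := innerSL_surjective ha r
    have hx : x ∈ interior (innerSL ℝ a ⁻¹' cell N i) := by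
      rwa [interior_preimage_innerSL ha]
    exact Set.disjoint_left.1 (disjoint_interior_region ha hiL) hx
      (h (Set.mem_biUnion hi (interior_subset hx)))
  exact fun K L h => subset_antisymm (key K L h.le) (key L K h.ge)

theorem region_inter_nonempty (ha : a ≠ 0) (K L : Set (Fin (N + 1))) :
    (region a N K ∩ region a N L).Nonempty ↔
      ∃ i j : Fin (N + 1), (i : ℕ) ≤ j + 1 ∧ (j : ℕ) ≤ i + 1 ∧ i ∈ K ∧ j ∈ L := by
  have hcell : ∀ i j : Fin (N + 1), (cell N i ∩ cell N j).Nonempty ↔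
      (i : ℕ) ≤ j + 1 ∧ (j : ℕ) ≤ i + 1 := fun i j =>
    cell_inter_cell_nonempty (Nat.lt_succ_iff.1 i.2) (Nat.lt_succ_iff.1 j.2)
  constructor
  · rintro ⟨x, hxK, hxL⟩
    obtain ⟨i, hi, hxi⟩ := Set.mem_iUnion₂.1 hxK
    obtain ⟨j, hj, hxj⟩ := Set.mem_iUnion₂.1 hxL
    obtain ⟨h₁, h₂⟩ := (hcell i j).1 ⟨_, hxi, hxj⟩
    exact ⟨i, j, h₁, h₂, hi, hj⟩
  · rintro ⟨i, j, h₁, h₂, hi, hj⟩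
    obtain ⟨r, hri, hrj⟩ := (hcell i j).2 ⟨h₁, h₂⟩
    obtain ⟨x, rfl⟩ := innerSL_surjective ha r
    exact ⟨x, Set.mem_biUnion hi hri, Set.mem_biUnion hj hrj⟩

end Region

/-! ### Completeness -/

/-- The union-of-slabs valuation makes exactly the formulas of the maximal theory true, among
those in the variables of `φ`. -/
theorem exists_not_isTrue {n : ℕ} (hn : 0 < n) {φ : CFormula} (h : ¬ Provable φ) :
    ¬ (polytopeAlgebra n).IsTrue φ := by
  obtain ⟨T, hT⟩ := exists_isMaximalTheory h
  have hC := hT.isConnectedContact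
  let v : ℕ → Lindenbaum hT.isTheory := fun i => Lindenbaum.mk _ (.var i)
  have hmk : ∀ t, boolEval v t = Lindenbaum.mk hT.isTheory t := Lindenbaum.boolEval_mk
  let S := φ.vars
  have hnt : (⊤ : Lindenbaum hT.isTheory) ≠ ⊥ := by
    rw [← Lindenbaum.mk_one, ← Lindenbaum.mk_zero, ne_comm, Ne, Lindenbaum.mk_eq_mk,
      ← hT.neg_mem_iff]
    exact hT.isTheory.ax .zero_ne_one
  have : Nonempty (AtomIndex v S) :=
    let ⟨w, _⟩ := hC.exists_inf_atom (v := v) (S := S) (hC.self hnt)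
    ⟨w⟩
  obtain ⟨N, hN, p, hp⟩ := exists_path_cover
    (R := fun w w' : AtomIndex v S => Lindenbaum.contact hT.isTheory (atom v S w.1) (atom v S w'.1))
    (fun w => hC.self w.2.2) (fun _ _ h => hC.symm h) hC.reflTransGen_atom
  have hpsurj : Function.Surjective p := fun w =>
    let ⟨i, _, _, _, hi, _⟩ := (hp w w).1 (hC.self w.2.2)
    ⟨i, hi⟩
  have : Nonempty (Fin n) := ⟨⟨0, hn⟩⟩
  obtain ⟨a, ha⟩ := exists_ne (0 : E n)
  -- a variable is sent to the union of the slabs whose atom lies below it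
  let u : ℕ → (polytopeAlgebra n).carrier := fun k =>
    ⟨region a N {i | k ∈ (p i).1}, isPolytope_region ha _⟩
  have heval : ∀ t : CTerm, ((polytopeAlgebra n).eval u t).1 =
      region a N (boolEval (fun k => {i | k ∈ (p i).1}) t) := by
    intro t
    induction t with
    | var k => rfl
    | compl t ih =>
      change star ((polytopeAlgebra n).eval u t).1 = _
      rw [ih, star_region ha hN]
      rfl
    | join s t ihs iht =>
      change ((polytopeAlgebra n).eval u s).1 ∪ ((polytopeAlgebra n).eval u t).1 = _
      rw [ihs, iht, ← region_union]
      rfl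
  have htruth : ∀ ψ : CFormula, ψ.vars ⊆ S → ((polytopeAlgebra n).Sat u ψ ↔ ψ ∈ T) := by
    intro ψ
    induction ψ with
    | eq s t =>
      intro hv
      refine Subtype.ext_iff.trans ?_
      rw [← Lindenbaum.mk_eq_mk (hT := hT.isTheory), ← hmk, ← hmk,
        boolEval_eq_iff (Finset.union_subset_left hv) (Finset.union_subset_right hv),
        heval, heval, (region_injective ha).eq_iff, Set.ext_iff,
        hpsurj.forall]
      exact forall_congr' fun i =>
        iff_congr (boolEval_set_iff (fun i => (p i).1) i s) (boolEval_set_iff _ i t)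
    | contact s t =>
      intro hv
      change (((polytopeAlgebra n).eval u s).1 ∩ ((polytopeAlgebra n).eval u t).1).Nonempty ↔ _
      rw [← Lindenbaum.contact_mk (hT := hT.isTheory), ← hmk, ← hmk,
        hC.boolEval_iff (Finset.union_subset_left hv) (Finset.union_subset_right hv),
        heval, heval, region_inter_nonempty ha]
      constructor
      · rintro ⟨i, j, hij, hji, hi, hj⟩
        exact ⟨p i, p j, (hp _ _).2 ⟨i, j, hij, hji, rfl, rfl⟩,
          (boolEval_set_iff (fun i => (p i).1) i s).1 hi,
          (boolEval_set_iff (fun i => (p i).1) j t).1 hj⟩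
      · rintro ⟨w, w', hw, hs, ht⟩
        obtain ⟨i, j, hij, hji, rfl, rfl⟩ := (hp _ _).1 hw
        exact ⟨i, j, hij, hji, (boolEval_set_iff (fun i => (p i).1) i s).2 hs,
          (boolEval_set_iff (fun i => (p i).1) j t).2 ht⟩
    | neg ψ ih =>
      intro hv
      rw [hT.neg_mem_iff, ← ih hv]
      rfl
    | or ψ χ ihψ ihχ =>
      intro hv
      rw [hT.or_mem_iff, ← ihψ (Finset.union_subset_left hv),
        ← ihχ (Finset.union_subset_right hv)]
      rfl
  exact fun htrue => hT.prop.2 ((htruth φ subset_rfl).1 (htrue u))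

theorem universalLogic_eq_theoremSet {n : ℕ} (hn : 0 < n) :
    (polytopeAlgebra n).universalLogic = theoremSet :=
  Set.ext fun _ => ⟨fun h => by_contra fun hp => exists_not_isTrue hn hp h, Provable.isTrue⟩

end ContactLogic

theorem mainTheorem4 :
    (∀ n : ℕ, 0 < n → ∀ φ : ContactLogic.CFormula,
      (ContactLogic.polytopeAlgebra n).IsTrue φ → ContactLogic.Provable φ) ∧
    (∀ n : ℕ, 0 < n →
      (ContactLogic.polytopeAlgebra n).universalLogic = ContactLogic.theoremSet) ∧
    (∀ m n : ℕ, 0 < m → 0 < n →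
      (ContactLogic.polytopeAlgebra m).universalLogic =
        (ContactLogic.polytopeAlgebra n).universalLogic) := by
  refine ⟨fun n hn φ h => ?_, fun n hn => ContactLogic.universalLogic_eq_theoremSet hn,
    fun m n hm hn => ?_⟩
  · exact (ContactLogic.universalLogic_eq_theoremSet hn).le h
  · rw [ContactLogic.universalLogic_eq_theoremSet hm, ContactLogic.universalLogic_eq_theoremSet hn]
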